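/- Let $\mathbb K=\mathbb R$ or $\mathbb C$, let $n\ge 2$ and $m\ge 1$ be integers, let $G=\mathrm{GL}_n(\mathbb K)$, and let $P\subset G$ be a maximal parabolic subgroup with $G/P\cong\mathbb P^{n-1}\mathbb K$. Thus $G^m/P^m\cong(\mathbb P^{n-1}\mathbb K)^m$ is the set of tuples $F=(\mathbb K^n;L_1,\dots,L_m)$ of lines in $\mathbb K^n$, on which $G$ acts diagonally. An $m$-tuple flag is a tuple $D=(V;V^{(1)},\dots,V^{(m)})$ consisting of a finite-dimensional $\mathbb K$-vector space and $m$ subspaces; its dimension vector is $\dim D=(\dim V;\dim V^{(1)},\dots,\dim V^{(m)})$. Direct sums are formed componentwise, and an isomorphism is a linear isomorphism of the ambient spaces carrying $V^{(i)}$ onto the $i$-th subspace of the target for each $i$. A flag is indecomposable if it is not isomorphic to a direct sum of two flags with non-zero ambient spaces. For $K\subset\{1,\dots,m\}$ and $r\in\mathbb N$ put $\mathbf d(K,r)=(r;\delta_{1,K},\dots,\delta_{m,K})$, where $\delta_{i,K}=1$ if $i\in K$ and $0$ otherwise. Let $\mathcal P_{n,m}$ be the set of all $p=(\{I_a\}_{a=1}^A,\{J_b\}_{b=1}^B,\{(K_c,r_c)\}_{c=1}^C)$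 such that the sets $I_a,J_b,K_c$ form a partition of $\{1,\dots,m\}$, $\#I_a\ge1$, $\#J_b\ge3$, $r_c\in\mathbb N$, $4\le r_c+2\le\#K_c$, and $r(p):=A+\sum_{b}(\#J_b-1)+\sum_c r_c\le n$. A flag is $p$-constructible if it is isomorphic to a direct sum of indecomposable flags consisting of $n-r(p)$ flags of dimension vector $\mathbf d(\emptyset,1)$ and one flag of each of the dimension vectors $\mathbf d(I_a,1)$, $\mathbf d(J_b,\#J_b-1)$, $\mathbf d(K_c,r_c)$ $(1\le a\le A$, $1\le b\le B$, $1\le c\le C)$. Let $\pi^{-1}(p)$ denote the set of all $G$-orbits of $p$-constructible elements of $G^m/P^m$. Let $p=(\{I_a\}_{a=1}^A,\{J_b\}_{b=1}^B,\{(K_c,r_c)\}_{c=1}^C)\in\mathcal P_{n,m}$. Then: 1. Every orbit $O\in\pi^{-1}(p)$ contains an element $F$ whose stabiliser in $G$ is the group of all invertible block matrices $$\begin{pmatrix} D&0&0&*\\ 0&\mathrm{diag}(E_1,\dots,E_B)&0&*\\ 0&0&\mathrm{diag}(F_1,\dots,F_C)&*\\ 0&0&0&*\end{pmatrix},$$ where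 $D=\mathrm{diag}(d_1,\dots,d_A)$ with $d_a\in\mathbb K^\times$, $E_b=e_b\mathbf 1$ has size $\#J_b-1$ with $e_b\in\mathbb K^\times$, $F_c=f_c\mathbf 1$ has size $r_c$ with $f_c\in\mathbb K^\times$, and the last block column, of width $n-r(p)$, is arbitrary (subject to invertibility). 2. In particular, the conjugacy class of stabilisers does not depend on the orbit: the stabilisers in $G$ of any two elements of $G^m/P^m$ whose orbits belong to $\pi^{-1}(p)$ are conjugate. 3. Every orbit $O\in\pi^{-1}(p)$ is a submanifold of $(\mathbb P^{n-1}\mathbb K)^m$ of dimension (over $\mathbb K$) $$\dim O=n\,r(p)-A-B-C.$$ -/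

import Mathlib

open scoped LinearAlgebra.Projectivization ContDiff MatrixGroups

universe u

/-! ### Tuples of subspaces ("`m`-tuple flags") -/

/-- An `m`-tuple flag `(V; V⁽¹⁾, …, V⁽ᵐ⁾)`: a finite-dimensional vector space together with `m`
subspaces. -/
structure MTupleFlag (𝕜 : Type u) [Field 𝕜] (m : ℕ) where
  carrier : Type u
  [addCommGroup : AddCommGroup carrier]
  [module : Module 𝕜 carrier]
  [finite : FiniteDimensional 𝕜 carrier]
  sub : Fin m → Submodule 𝕜 carrier

attribute [instance] MTupleFlag.addCommGroup MTupleFlag.module MTupleFlag.finite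

namespace MTupleFlag

variable {𝕜 : Type u} [Field 𝕜] {m : ℕ}

/-- The dimension vector `(dim V; dim V⁽¹⁾, …, dim V⁽ᵐ⁾)`. -/
noncomputable def dimVec (D : MTupleFlag 𝕜 m) : ℕ × (Fin m → ℕ) :=
  (Module.finrank 𝕜 D.carrier, fun i => Module.finrank 𝕜 (D.sub i))

/-- Isomorphism: a linear isomorphism of the ambient spaces which carries the `i`-th subspace onto
the `i`-th subspace for every `i`. -/
def Iso (D E : MTupleFlag 𝕜 m) : Prop :=
  ∃ f : D.carrier ≃ₗ[𝕜] E.carrier, ∀ i, (D.sub i).map f.toLinearMap = E.sub i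

/-- The direct sum `(V ⊕ W; V⁽ⁱ⁾ ⊕ W⁽ⁱ⁾)` of two flags. -/
def prod (D E : MTupleFlag 𝕜 m) : MTupleFlag 𝕜 m where
  carrier := D.carrier × E.carrier
  sub i := (D.sub i).prod (E.sub i)

/-- The direct sum of a finite family of flags. -/
def directSum {S : Type} [Finite S] (D : S → MTupleFlag 𝕜 m) : MTupleFlag 𝕜 m where
  carrier := ∀ s, (D s).carrier
  sub i := Submodule.pi Set.univ fun s => (D s).sub i

/-- A flag is trivial if its ambient space is zero. -/
def IsTrivial (D : MTupleFlag 𝕜 m) : Prop := Subsingleton D.carrier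

/-- A flag is indecomposable if it is not isomorphic to a direct sum of two non-trivial flags. -/
def Indecomposable (D : MTupleFlag 𝕜 m) : Prop :=
  ¬ ∃ E F : MTupleFlag 𝕜 m, ¬ E.IsTrivial ∧ ¬ F.IsTrivial ∧ D.Iso (E.prod F)

end MTupleFlag

/-- The dimension vector `d(K, r) = (r; δ_{1,K}, …, δ_{m,K})`. -/
def dimVecOf {m : ℕ} (K : Finset (Fin m)) (r : ℕ) : ℕ × (Fin m → ℕ) :=
  (r, fun i => if i ∈ K then 1 else 0)

/-! ### The finite set `𝒫_{n,m}` -/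

/-- The set `𝒫_{n,m}` of all `p = ({I_a}, {J_b}, {(K_c, r_c)})`, where the sets `I_a, J_b, K_c`
form a partition of `{1, …, m}` and the size conditions hold. -/
structure SplittingType (n m : ℕ) where
  I : Finset (Finset (Fin m))
  J : Finset (Finset (Fin m))
  K : Finset (Finset (Fin m) × ℕ)
  pairwise_disjoint : Pairwise fun s t : I ⊕ J ⊕ K =>
    Disjoint (Sum.elim (fun a : I => a.1) (Sum.elim (fun b : J => b.1) fun c : K => c.1.1) s)
      (Sum.elim (fun a : I => a.1) (Sum.elim (fun b : J => b.1) fun c : K => c.1.1) t)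
  cover : ∀ i : Fin m, (∃ a ∈ I, i ∈ a) ∨ (∃ b ∈ J, i ∈ b) ∨ ∃ c ∈ K, i ∈ c.1
  one_le_card : ∀ a ∈ I, 1 ≤ a.card
  three_le_card : ∀ b ∈ J, 3 ≤ b.card
  four_le : ∀ c ∈ K, 4 ≤ c.2 + 2 ∧ c.2 + 2 ≤ c.1.card
  rank_le : I.card + ∑ b ∈ J, (b.card - 1) + ∑ c ∈ K, c.2 ≤ n

namespace SplittingType

variable {n m : ℕ}

/-- `r(p) = A + ∑_b (#J_b - 1) + ∑_c r_c`. -/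
def rank (p : SplittingType n m) : ℕ :=
  p.I.card + ∑ b ∈ p.J, (b.card - 1) + ∑ c ∈ p.K, c.2

/-- The index set of the summands in a splitting of type `p`. -/
abbrev Summand (p : SplittingType n m) : Type :=
  Fin (n - p.rank) ⊕ p.I ⊕ p.J ⊕ p.K

/-- The dimension vectors of the summands in a splitting of type `p`: `n - r(p)` times `d(∅, 1)`,
then `d(I_a, 1)`, `d(J_b, #J_b - 1)` and `d(K_c, r_c)`. -/
def summandDimVec (p : SplittingType n m) : p.Summand → ℕ × (Fin m → ℕ) :=
  Sum.elim (fun _ => dimVecOf ∅ 1) <|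
    Sum.elim (fun a => dimVecOf a.1 1) <|
      Sum.elim (fun b => dimVecOf b.1 (b.1.card - 1)) fun c => dimVecOf c.1.1 c.1.2

/-- A flag is `p`-constructible if it is isomorphic to a direct sum of indecomposable flags with
the dimension vectors prescribed by `p`. -/
def Constructible {𝕜 : Type u} [Field 𝕜] (p : SplittingType n m) (F : MTupleFlag 𝕜 m) : Prop :=
  ∃ D : p.Summand → MTupleFlag 𝕜 m,
    (∀ s, (D s).Indecomposable ∧ (D s).dimVec = p.summandDimVec s) ∧
      F.Iso (MTupleFlag.directSum D)

end SplittingType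

/-! ### The multiple flag variety `Gᵐ/Pᵐ ≅ (ℙⁿ⁻¹)ᵐ` with the diagonal action of `G = GLₙ` -/

/-- `Gᵐ/Pᵐ ≅ (ℙⁿ⁻¹ 𝕜)ᵐ`: the `m`-tuples of lines in `𝕜ⁿ`. The group `GLₙ(𝕜)` acts on it
diagonally, `(g • F) i = g • F i`. -/
abbrev FlagVariety (𝕜 : Type u) [Field 𝕜] (n m : ℕ) : Type u :=
  Fin m → ℙ 𝕜 (Fin n → 𝕜)

/-- The `m`-tuple flag `(𝕜ⁿ; F₁, …, F_m)` given by an `m`-tuple of lines in `𝕜ⁿ`. -/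
def FlagVariety.toFlag {𝕜 : Type u} [Field 𝕜] {n m : ℕ} (F : FlagVariety 𝕜 n m) :
    MTupleFlag 𝕜 m where
  carrier := Fin n → 𝕜
  sub i := (F i).submodule

/-- The fibre `π⁻¹(p)` of `diag(G) ⬝ F ↦ p_F`: the set of the `diag(G)`-orbits of the
`p`-constructible elements of `Gᵐ/Pᵐ`. -/
def SplittingType.fibre (𝕜 : Type u) [Field 𝕜] {n m : ℕ} (p : SplittingType n m) :
    Set (MulAction.orbitRel.Quotient (GL (Fin n) 𝕜) (FlagVariety 𝕜 n m)) :=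
  {O | ∃ F ∈ O.orbit, p.Constructible F.toFlag}

/-! ### The block group -/

/-- Row (and column) indices of the block matrices attached to
`p = ({I_a}_{a=1}^A, {J_b}_{b=1}^B, {(K_c, r_c)}_{c=1}^C)`: a block of size `A`, blocks of sizes
`#J_b - 1`, blocks of sizes `r_c`, and a last block of size `n - r(p)`. -/
abbrev BlockIndex {n m : ℕ} (p : SplittingType n m) (A : ℕ) {B C : ℕ}
    (J : Fin B ≃ p.J) (K : Fin C ≃ p.K) : Type :=
  (Fin A ⊕ (Σ b : Fin B, Fin ((J b).1.card - 1)) ⊕ (Σ c : Fin C, Fin (K c).1.2)) ⊕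
    Fin (n - p.rank)

theorem blockIndex_card {n m : ℕ} (p : SplittingType n m) {A B C : ℕ}
    (I : Fin A ≃ p.I) (J : Fin B ≃ p.J) (K : Fin C ≃ p.K) :
    (A + (∑ b : Fin B, ((J b).1.card - 1) + ∑ c : Fin C, (K c).1.2)) + (n - p.rank) = n := by
  have hA : A = p.I.card := by simpa using Fintype.card_congr I
  have hB : ∑ b : Fin B, ((J b).1.card - 1) = ∑ b ∈ p.J, (b.card - 1) := by
    rw [J.sum_comp (fun b : p.J => b.1.card - 1), ← Finset.sum_coe_sort p.J]
  have hC : ∑ c : Fin C, (K c).1.2 = ∑ c ∈ p.K, c.2 := by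
    rw [K.sum_comp (fun c : p.K => c.1.2), ← Finset.sum_coe_sort p.K]
  have h := p.rank_le
  simp only [SplittingType.rank]
  omega

/-- The blocks are placed one after the other along `{1, …, n}`. -/
def blockEquiv {n m : ℕ} (p : SplittingType n m) {A B C : ℕ}
    (I : Fin A ≃ p.I) (J : Fin B ≃ p.J) (K : Fin C ≃ p.K) :
    BlockIndex p A J K ≃ Fin n :=
  (Equiv.sumCongr
    ((Equiv.sumCongr (Equiv.refl _)
      ((Equiv.sumCongr finSigmaFinEquiv finSigmaFinEquiv).trans finSumFinEquiv)).trans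
        finSumFinEquiv) (Equiv.refl _)).trans
    (finSumFinEquiv.trans (finCongr (blockIndex_card p I J K)))

/-- The group of all invertible block matrices
`[[D, 0, 0, *], [0, diag(E_b), 0, *], [0, 0, diag(F_c), *], [0, 0, 0, *]]`, where
`D = diag(d₁, …, d_A)`, `E_b = e_b 1` has size `#J_b - 1`, `F_c = f_c 1` has size `r_c`, the `d_a`,
`e_b`, `f_c` are non-zero scalars, and the last block column is arbitrary. -/
def blockGroup (𝕜 : Type u) [Field 𝕜] {n m : ℕ} (p : SplittingType n m) {A B C : ℕ}
    (I : Fin A ≃ p.I) (J : Fin B ≃ p.J) (K : Fin C ≃ p.K) : Set (GL (Fin n) 𝕜) :=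
  {g | ∃ (d : Fin A → 𝕜ˣ) (e : Fin B → 𝕜ˣ) (f : Fin C → 𝕜ˣ)
      (X : Matrix (Fin A ⊕ (Σ b : Fin B, Fin ((J b).1.card - 1)) ⊕ (Σ c : Fin C, Fin (K c).1.2))
        (Fin (n - p.rank)) 𝕜)
      (Y : Matrix (Fin (n - p.rank)) (Fin (n - p.rank)) 𝕜),
    (g : Matrix (Fin n) (Fin n) 𝕜) =
      Matrix.reindex (blockEquiv p I J K) (blockEquiv p I J K)
        (Matrix.fromBlocks
          (Matrix.fromBlocks (Matrix.diagonal fun a => (d a : 𝕜)) 0 0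
            (Matrix.fromBlocks
              (Matrix.blockDiagonal' fun b =>
                (e b : 𝕜) • (1 : Matrix (Fin ((J b).1.card - 1)) (Fin ((J b).1.card - 1)) 𝕜))
              0 0
              (Matrix.blockDiagonal' fun c =>
                (f c : 𝕜) • (1 : Matrix (Fin (K c).1.2) (Fin (K c).1.2) 𝕜))))
          X 0 Y)}

/-! ### Dimension of submanifolds of `(ℙⁿ⁻¹)ᵐ` -/

/-- `M` is an embedded `𝕜`-analytic submanifold of dimension `d` of the normed space `E`: near each
of its points it is the image of an analytic immersion of an open subset of `𝕜ᵈ` which is a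
homeomorphism onto its image. -/
def IsEmbeddedSubmanifold (𝕜 : Type*) [RCLike 𝕜] {E : Type*} [NormedAddCommGroup E]
    [NormedSpace 𝕜 E] (M : Set E) (d : ℕ) : Prop :=
  ∀ x ∈ M, ∃ U : Set E, IsOpen U ∧ x ∈ U ∧
    ∃ (W : Set (Fin d → 𝕜)) (θ : (Fin d → 𝕜) → E) (ρ : E → (Fin d → 𝕜)),
      IsOpen W ∧ ContDiffOn 𝕜 ω θ W ∧ (∀ w ∈ W, Function.Injective (fderiv 𝕜 θ w)) ∧
      Set.BijOn θ W (M ∩ U) ∧ Set.LeftInvOn ρ θ W ∧ ContinuousOn ρ (M ∩ U)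

/-- The `j`-th standard affine chart (its inverse) `𝕜ⁿ⁻¹ → ℙⁿ⁻¹`, which inserts the entry `1` at
position `j`. -/
def affineChart {𝕜 : Type u} [Field 𝕜] {n : ℕ} (j : Fin n) (z : {k : Fin n // k ≠ j} → 𝕜) :
    ℙ 𝕜 (Fin n → 𝕜) :=
  Projectivization.mk 𝕜 (fun k => if h : k = j then 1 else z ⟨k, h⟩) fun h0 => by
    simpa using congrFun h0 j

/-- `S ⊆ (ℙⁿ⁻¹)ᵐ` is an embedded submanifold of dimension `d`: it is one in each of the products of
standard affine charts (which cover `(ℙⁿ⁻¹)ᵐ`). -/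
def HasDimension {𝕜 : Type u} [RCLike 𝕜] {n m : ℕ} (S : Set (FlagVariety 𝕜 n m)) (d : ℕ) : Prop :=
  ∀ j : Fin m → Fin n,
    IsEmbeddedSubmanifold 𝕜
      {z : (i : Fin m) → ({k : Fin n // k ≠ j i} → 𝕜) | (fun i => affineChart (j i) (z i)) ∈ S} d

/-! Split a `p`-constructible tuple of lines into its indecomposable summands. An endomorphism that
preserves the lines of a summand containing at least one of them is scalar there: each line lies in
an eigenspace and the lines span, so the eigenspaces decompose the summand, and indecomposability
leaves only one (`Indecomposable.exists_eq_smul`).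

Every line lies in exactly one non-trivial summand. Bases of the summands therefore combine to a
basis of `𝕜ⁿ` in which the stabiliser consists of the invertible maps that are scalar on each
non-trivial summand and unconstrained on the other `n - r(p)` basis vectors
(`Constructible.exists_isAdapted`, `IsAdapted.smul_eq_self_iff`). This shape depends on `p` alone,
so carrying the basis to the standard one settles the claims on stabilisers.

For the dimension, `g • F` depends only on `g` restricted to the span of the non-trivial summands,
which has `n * r(p)` parameters, up to one scalar for each of the `A + B + C` summands. A linear
normalisation of these scalars leaves a linear family `1 + Q t` transversal to the stabiliser
(`IsAdapted.exists_linear_family`). In affine charts the parameter `t` is recovered from the tuple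
by solving a linear system, so it depends continuously on the tuple; hence the orbit is embedded and
not merely immersed (`exists_orbit_parametrization`). -/

namespace MTupleFlag

/-! ### Endomorphisms of indecomposable flags -/

variable {𝕜 : Type u} [Field 𝕜] {m : ℕ}

/-- A subspace contained in one of two complementary summands is the direct sum of its intersections
with both, so the flag splits as its restrictions to `V` and `W`. -/
theorem not_indecomposable_of_isCompl (D : MTupleFlag 𝕜 m) {V W : Submodule 𝕜 D.carrier}
    (h : IsCompl V W) (hV : V ≠ ⊥) (hW : W ≠ ⊥) (hD : ∀ i, D.sub i ≤ V ∨ D.sub i ≤ W) :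
    ¬ D.Indecomposable := by
  intro hind
  refine hind ⟨{ carrier := V, sub := fun i => (D.sub i).comap V.subtype },
    { carrier := W, sub := fun i => (D.sub i).comap W.subtype }, ?_, ?_,
    (Submodule.prodEquivOfIsCompl V W h).symm, fun i => ?_⟩
  · exact fun hs => hV (Submodule.subsingleton_iff_eq_bot.1 hs)
  · exact fun hs => hW (Submodule.subsingleton_iff_eq_bot.1 hs)
  · change (D.sub i).map (Submodule.prodEquivOfIsCompl V W h).symm.toLinearMap =
      ((D.sub i).comap V.subtype).prod ((D.sub i).comap W.subtype)
    ext ⟨x, y⟩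
    simp only [Submodule.mem_map, Submodule.mem_prod, Submodule.mem_comap, Submodule.subtype_apply]
    constructor
    · rintro ⟨v, hv, hxy⟩
      have hv' : v = x + y := by
        have := congrArg (Submodule.prodEquivOfIsCompl V W h) hxy
        rw [LinearEquiv.coe_coe] at this
        simpa only [LinearEquiv.apply_symm_apply, Submodule.coe_prodEquivOfIsCompl'] using this
      subst hv'
      rcases hD i with hi | hi
      · have hy : (y : D.carrier) = 0 := by
          have : (y : D.carrier) ∈ V := by
            simpa using V.sub_mem (hi hv) x.2
          exact Submodule.disjoint_def.1 h.disjoint _ this y.2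
        rw [hy, add_zero] at hv
        exact ⟨hv, by rw [hy]; exact Submodule.zero_mem _⟩
      · have hx : (x : D.carrier) = 0 := by
          have : (x : D.carrier) ∈ W := by
            simpa using W.sub_mem (hi hv) y.2
          exact Submodule.disjoint_def.1 h.disjoint _ x.2 this
        rw [hx, zero_add] at hv
        exact ⟨by rw [hx]; exact Submodule.zero_mem _, hv⟩
    · rintro ⟨hx, hy⟩
      refine ⟨x + y, Submodule.add_mem _ hx hy, ?_⟩
      apply (Submodule.prodEquivOfIsCompl V W h).injective
      simp

/-- Otherwise a complement of the span would split off as a flag all of whose subspaces are zero. -/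
theorem Indecomposable.iSup_sub_eq_top {D : MTupleFlag 𝕜 m} (hD : D.Indecomposable) {i : Fin m}
    (hi : D.sub i ≠ ⊥) : ⨆ i, D.sub i = ⊤ := by
  obtain ⟨W, hW⟩ := Submodule.exists_isCompl (⨆ i, D.sub i)
  by_contra hne
  refine D.not_indecomposable_of_isCompl hW ?_ ?_ (fun i => Or.inl (le_iSup D.sub i)) hD
  · exact fun h0 => hi (eq_bot_iff.2 (h0 ▸ le_iSup D.sub i))
  · rintro rfl
    exact hne (by simpa using hW.sup_eq_top)

theorem le_eigenspace_of_finrank_le_one {V : Type*} [AddCommGroup V] [Module 𝕜 V]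
    [FiniteDimensional 𝕜 V] (L : Submodule 𝕜 V) (hL : Module.finrank 𝕜 L ≤ 1) (h : Module.End 𝕜 V)
    (hh : L.map h ≤ L) : ∃ c, L ≤ h.eigenspace c := by
  obtain ⟨v, hv⟩ := finrank_le_one_iff.1 hL
  obtain ⟨c, hc⟩ := hv ⟨h v, hh ⟨v, v.2, rfl⟩⟩
  refine ⟨c, fun w hw => ?_⟩
  obtain ⟨a, ha⟩ := hv ⟨w, hw⟩
  have ha' : a • (v : V) = w := congrArg Subtype.val ha
  have hc' : c • (v : V) = h v := congrArg Subtype.val hc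
  rw [Module.End.mem_eigenspace_iff, ← ha', map_smul, ← hc', smul_comm]

/-- The eigenvalues lie in `𝕜` because they are read off on invariant lines, so no algebraic
closedness is needed. The eigenspace of one line and the sum of all other eigenspaces are
complementary, and each line lies in one of the two; indecomposability makes the second one zero. -/
theorem Indecomposable.exists_eq_smul {D : MTupleFlag 𝕜 m} (hD : D.Indecomposable)
    (hD1 : ∀ i, Module.finrank 𝕜 (D.sub i) ≤ 1) {i : Fin m} (hi : D.sub i ≠ ⊥)
    (h : Module.End 𝕜 D.carrier) (hh : ∀ i, (D.sub i).map h ≤ D.sub i) :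
    ∃ c : 𝕜, ∀ v, h v = c • v := by
  choose c hc using fun i => le_eigenspace_of_finrank_le_one (D.sub i) (hD1 i) h (hh i)
  have hle : ∀ k, D.sub k ≤ h.eigenspace (c i) ∨ D.sub k ≤ ⨆ μ ≠ c i, h.eigenspace μ := by
    intro k
    by_cases hk : c k = c i
    · exact Or.inl (hk ▸ hc k)
    · exact Or.inr ((hc k).trans (le_iSup₂ (f := fun μ (_ : μ ≠ c i) => h.eigenspace μ) (c k) hk))
  have hcompl : IsCompl (h.eigenspace (c i)) (⨆ μ ≠ c i, h.eigenspace μ) := by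
    refine ⟨h.eigenspaces_iSupIndep (c i), codisjoint_iff.2 (eq_top_iff.2 ?_)⟩
    rw [← hD.iSup_sub_eq_top hi]
    exact iSup_le fun k => (hle k).elim (fun h => h.trans le_sup_left) fun h => h.trans le_sup_right
  have hW : (⨆ μ ≠ c i, h.eigenspace μ) = ⊥ := by
    by_contra hne
    exact D.not_indecomposable_of_isCompl hcompl
      (fun h0 => hi (eq_bot_iff.2 (h0 ▸ hc i))) hne hle hD
  have htop : h.eigenspace (c i) = ⊤ := by simpa [hW] using hcompl.sup_eq_top
  refine ⟨c i, fun v => ?_⟩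
  rw [← Module.End.mem_eigenspace_iff, htop]
  trivial

end MTupleFlag

/-- A basis of `𝕜ⁿ`, indexed by the disjoint union of blocks `blk ⁻¹' {s}` and a remainder `κ`, is
adapted to a tuple of lines if each line lies in the span of a block, each block contains a line,
and the endomorphisms preserving all the lines act by a scalar on each block. -/
structure FlagVariety.IsAdapted {𝕜 : Type u} [Field 𝕜] {n m : ℕ} (F : FlagVariety 𝕜 n m)
    {σ ι κ : Type} (blk : ι → σ) (e : Module.Basis (ι ⊕ κ) 𝕜 (Fin n → 𝕜)) : Prop where
  exists_block : ∀ i, ∃ s,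
    (F i).submodule ≤ Submodule.span 𝕜 ((fun x => e (Sum.inl x)) '' (blk ⁻¹' {s}))
  exists_line : ∀ s, ∃ i,
    (F i).submodule ≤ Submodule.span 𝕜 ((fun x => e (Sum.inl x)) '' (blk ⁻¹' {s}))
  scalar : ∀ h : Module.End 𝕜 (Fin n → 𝕜), (∀ i, (F i).submodule.map h ≤ (F i).submodule) →
    ∃ c : σ → 𝕜, ∀ x, h (e (Sum.inl x)) = c (blk x) • e (Sum.inl x)

/-! ### Adapted bases of constructible tuples -/

namespace SplittingType

variable {𝕜 : Type u} [Field 𝕜] {n m : ℕ} (p : SplittingType n m)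

/-- The index set of the non-trivial summands. -/
abbrev Core : Type := p.I ⊕ p.J ⊕ p.K

/-- The set of lines which lie in a non-trivial summand. -/
def coreSet (s : p.Core) : Finset (Fin m) :=
  Sum.elim (fun a : p.I => a.1) (Sum.elim (fun b : p.J => b.1) fun c : p.K => c.1.1) s

/-- The dimension of a non-trivial summand. -/
def coreDim (s : p.Core) : ℕ :=
  Sum.elim (fun _ : p.I => 1) (Sum.elim (fun b : p.J => b.1.card - 1) fun c : p.K => c.1.2) s

theorem summandDimVec_inr (s : p.Core) :
    p.summandDimVec (Sum.inr s) = dimVecOf (p.coreSet s) (p.coreDim s) := by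
  rcases s with a | b | c <;> rfl

theorem coreSet_nonempty (s : p.Core) : (p.coreSet s).Nonempty := by
  rw [← Finset.card_pos]
  rcases s with a | b | c
  · exact p.one_le_card _ a.2
  · exact lt_of_lt_of_le (by norm_num) (p.three_le_card _ b.2)
  · have := p.four_le _ c.2
    change 0 < c.1.1.card
    omega

theorem exists_mem_coreSet (i : Fin m) : ∃ s, i ∈ p.coreSet s := by
  rcases p.cover i with ⟨a, ha, h⟩ | ⟨b, hb, h⟩ | ⟨c, hc, h⟩
  · exact ⟨Sum.inl ⟨a, ha⟩, h⟩
  · exact ⟨Sum.inr (Sum.inl ⟨b, hb⟩), h⟩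
  · exact ⟨Sum.inr (Sum.inr ⟨c, hc⟩), h⟩

theorem not_mem_coreSet {i : Fin m} {s t : p.Core} (hst : t ≠ s) (hi : i ∈ p.coreSet s) :
    i ∉ p.coreSet t :=
  fun h => Finset.disjoint_left.1 (p.pairwise_disjoint hst) h hi

/-- The basis is the union of bases of the summands, the one-dimensional summands without lines
providing the part indexed by `κ`. The scalar property comes from indecomposability of each
non-trivial summand. -/
theorem Constructible.exists_isAdapted {p : SplittingType n m} {F : FlagVariety 𝕜 n m}
    (hF : p.Constructible F.toFlag) {ι κ : Type} (hκ : κ ≃ Fin (n - p.rank)) (blk : ι → p.Core)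
    (hι : ∀ s, Nonempty ({x // blk x = s} ≃ Fin (p.coreDim s))) :
    ∃ e : Module.Basis (ι ⊕ κ) 𝕜 (Fin n → 𝕜), F.IsAdapted blk e := by
  classical
  obtain ⟨D, hD, f, hf⟩ := hF
  change (Fin n → 𝕜) ≃ₗ[𝕜] (∀ s, (D s).carrier) at f
  change ∀ i, (F i).submodule.map f.toLinearMap =
    Submodule.pi Set.univ fun s => (D s).sub i at hf
  have hsub_inl : ∀ k i, (D (Sum.inl k)).sub i = ⊥ := by
    intro k i
    have : (D (Sum.inl k)).dimVec = dimVecOf ∅ 1 := (hD (Sum.inl k)).2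
    have := congrFun (congrArg Prod.snd this) i
    simpa [MTupleFlag.dimVec, dimVecOf] using this
  have hdim : ∀ s, Module.finrank 𝕜 (D (Sum.inr s)).carrier = p.coreDim s := fun s =>
    congrArg Prod.fst ((hD (Sum.inr s)).2.trans (p.summandDimVec_inr s))
  have hfin : ∀ s i, Module.finrank 𝕜 ((D (Sum.inr s)).sub i) =
      if i ∈ p.coreSet s then 1 else 0 := fun s i =>
    congrFun (congrArg Prod.snd ((hD (Sum.inr s)).2.trans (p.summandDimVec_inr s))) i
  have hdim0 : ∀ k, Module.finrank 𝕜 (D (Sum.inl k)).carrier = 1 := fun k =>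
    congrArg Prod.fst (hD (Sum.inl k)).2
  have hsub_not : ∀ s i, i ∉ p.coreSet s → (D (Sum.inr s)).sub i = ⊥ := by
    intro s i hi
    have := hfin s i
    rw [if_neg hi] at this
    exact Submodule.finrank_eq_zero.1 this
  have hsub_ne : ∀ s i, i ∈ p.coreSet s → (D (Sum.inr s)).sub i ≠ ⊥ := by
    intro s i hi h0
    have := hfin s i
    rw [if_pos hi, h0, finrank_bot] at this
    exact zero_ne_one this
  -- The index `i` belongs to a single core set, so the `i`-th subspace of the direct sum lives in
  -- one component.
  have hmem : ∀ s i, i ∈ p.coreSet s → ∀ w : ∀ s, (D s).carrier,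
      w ∈ (Submodule.pi Set.univ fun s => (D s).sub i) →
        w = Pi.single (Sum.inr s) (w (Sum.inr s)) := by
    intro s i hi w hw
    rw [Submodule.mem_pi] at hw
    funext t
    by_cases ht : t = Sum.inr s
    · subst ht; simp
    · rw [Pi.single_eq_of_ne ht]
      have h1 := hw t (Set.mem_univ t)
      rcases t with k | t
      · rw [hsub_inl] at h1
        exact (Submodule.mem_bot 𝕜).1 h1
      · have hts : t ≠ s := fun h => ht (congrArg Sum.inr h)
        rw [hsub_not t i (p.not_mem_coreSet hts hi)] at h1
        exact (Submodule.mem_bot 𝕜).1 h1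
  let bI : ∀ s : p.Core, Module.Basis {x // blk x = s} 𝕜 (D (Sum.inr s)).carrier := fun s =>
    (Module.finBasisOfFinrankEq 𝕜 _ (hdim s)).reindex (hι s).some.symm
  let bK : ∀ k : Fin (n - p.rank), Module.Basis Unit 𝕜 (D (Sum.inl k)).carrier := fun k =>
    (Module.finBasisOfFinrankEq 𝕜 _ (hdim0 k)).reindex (Equiv.ofUnique _ _)
  let ιs : p.Summand → Type := Sum.elim (fun _ => Unit) fun s => {x // blk x = s}
  let b : ∀ t : p.Summand, Module.Basis (ιs t) 𝕜 (D t).carrier := fun t =>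
    match t with
    | Sum.inl k => bK k
    | Sum.inr s => bI s
  let E : ι ⊕ κ ≃ Σ t, ιs t :=
    { toFun := Sum.elim (fun x => ⟨Sum.inr (blk x), ⟨x, rfl⟩⟩) fun k => ⟨Sum.inl (hκ k), ()⟩
      invFun := fun y => match y with
        | ⟨Sum.inl k, _⟩ => Sum.inr (hκ.symm k)
        | ⟨Sum.inr _, x⟩ => Sum.inl x.1
      left_inv := by rintro (x | k) <;> simp
      right_inv := by
        rintro ⟨k | s, x⟩
        · change (⟨Sum.inl (hκ (hκ.symm k)), ()⟩ : Σ t, ιs t) = ⟨Sum.inl k, ()⟩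
          rw [Equiv.apply_symm_apply]
        · obtain ⟨x, rfl⟩ := x
          rfl }
  let e : Module.Basis (ι ⊕ κ) 𝕜 (Fin n → 𝕜) := ((Pi.basis b).map f.symm).reindex E.symm
  have he : ∀ s (x : {x // blk x = s}), f (e (Sum.inl x.1)) = Pi.single (Sum.inr s) (bI s x) := by
    rintro s ⟨x, rfl⟩
    have : f (e (Sum.inl x)) = Pi.basis b ⟨Sum.inr (blk x), ⟨x, rfl⟩⟩ := by
      simp [e, E]
    rw [this, Pi.basis_apply]
    rfl
  let T : ∀ s : p.Core, (D (Sum.inr s)).carrier →ₗ[𝕜] (Fin n → 𝕜) := fun s =>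
    f.symm.toLinearMap ∘ₗ LinearMap.single 𝕜 (fun t => (D t).carrier) (Sum.inr s)
  have hT : ∀ s x, T s (bI s x) = e (Sum.inl x.1) := fun s x =>
    (f.symm_apply_eq).2 (he s x).symm
  have hTspan : ∀ s w, T s w ∈
      Submodule.span 𝕜 ((fun x => e (Sum.inl x)) '' (blk ⁻¹' {s})) := by
    intro s w
    have hw : w ∈ Submodule.span 𝕜 (Set.range (bI s)) := by rw [(bI s).span_eq]; trivial
    have := Submodule.mem_map_of_mem (f := T s) hw
    rw [Submodule.map_span] at this
    refine Submodule.span_mono ?_ this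
    rintro _ ⟨_, ⟨x, rfl⟩, rfl⟩
    exact ⟨x.1, x.2, (hT s x).symm⟩
  have hFT : ∀ s i, i ∈ p.coreSet s → ∀ v ∈ (F i).submodule,
      f v (Sum.inr s) ∈ (D (Sum.inr s)).sub i ∧ v = T s (f v (Sum.inr s)) := by
    intro s i hi v hv
    have h1 : f v ∈ Submodule.pi Set.univ fun s => (D s).sub i :=
      hf i ▸ Submodule.mem_map_of_mem hv
    exact ⟨Submodule.mem_pi.1 h1 _ trivial, (f.eq_symm_apply).2 (hmem s i hi _ h1)⟩
  have hTF : ∀ s i, ∀ w ∈ (D (Sum.inr s)).sub i, T s w ∈ (F i).submodule := by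
    intro s i w hw
    have h1 : f (T s w) ∈ (F i).submodule.map f.toLinearMap := by
      rw [hf i, Submodule.mem_pi]
      intro t _
      have : f (T s w) = Pi.single (Sum.inr s) w := f.apply_symm_apply _
      rw [this]
      by_cases ht : t = Sum.inr s
      · subst ht; simpa using hw
      · rw [Pi.single_eq_of_ne ht]; exact Submodule.zero_mem _
    obtain ⟨v, hv, hvw⟩ := h1
    exact f.injective hvw ▸ hv
  have hblock : ∀ s i, i ∈ p.coreSet s → (F i).submodule ≤
      Submodule.span 𝕜 ((fun x => e (Sum.inl x)) '' (blk ⁻¹' {s})) := by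
    intro s i hi v hv
    rw [(hFT s i hi v hv).2]
    exact hTspan s _
  refine ⟨e, fun i => ?_, fun s => ?_, fun h hh => ?_⟩
  · obtain ⟨s, hs⟩ := p.exists_mem_coreSet i
    exact ⟨s, hblock s i hs⟩
  · obtain ⟨i, hi⟩ := p.coreSet_nonempty s
    exact ⟨i, hblock s i hi⟩
  · have key : ∀ s : p.Core, ∃ c : 𝕜, ∀ w, h (T s w) = c • T s w := by
      intro s
      obtain ⟨i₀, hi₀⟩ := p.coreSet_nonempty s
      let q : (Fin n → 𝕜) →ₗ[𝕜] (D (Sum.inr s)).carrier :=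
        LinearMap.proj (Sum.inr s) ∘ₗ f.toLinearMap
      -- A priori `h` need not map the summand into itself. On its lines it does, and these span the
      -- summand, so `h` agrees there with the compression `q ∘ h ∘ T s`.
      have hpres : ∀ i, ∀ w ∈ (D (Sum.inr s)).sub i,
          q (h (T s w)) ∈ (D (Sum.inr s)).sub i ∧ h (T s w) = T s (q (h (T s w))) := by
        intro i w hw
        by_cases hi : i ∈ p.coreSet s
        · exact hFT s i hi _ (hh i ⟨_, hTF s i w hw, rfl⟩)
        · rw [hsub_not s i hi, Submodule.mem_bot] at hw
          subst hw
          simp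
      have htop : (⊤ : Submodule 𝕜 (D (Sum.inr s)).carrier) ≤
          LinearMap.eqLocus (h ∘ₗ T s) (T s ∘ₗ q ∘ₗ h ∘ₗ T s) := by
        rw [← (hD (Sum.inr s)).1.iSup_sub_eq_top (hsub_ne s i₀ hi₀)]
        exact iSup_le fun i w hw => (hpres i w hw).2
      obtain ⟨c, hc⟩ := (hD (Sum.inr s)).1.exists_eq_smul
        (fun i => by rw [hfin]; split_ifs <;> simp) (hsub_ne s i₀ hi₀) (q ∘ₗ h ∘ₗ T s)
        (by rintro i _ ⟨w, hw, rfl⟩; exact (hpres i w hw).1)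
      refine ⟨c, fun w => ?_⟩
      have h1 : h (T s w) = T s ((q ∘ₗ h ∘ₗ T s) w) := htop (x := w) trivial
      rw [h1, hc, map_smul]
    choose c hc using key
    refine ⟨c, fun x => ?_⟩
    rw [← hT (blk x) ⟨x, rfl⟩, hc]

end SplittingType

/-! ### Stabilisers in an adapted basis -/

section GeneralLinear

variable {𝕜 : Type u} [Field 𝕜] {n m : ℕ}

theorem exists_gl_toLin'_eq (φ : (Fin n → 𝕜) ≃ₗ[𝕜] (Fin n → 𝕜)) :
    ∃ g : GL (Fin n) 𝕜, Matrix.toLin' (g : Matrix (Fin n) (Fin n) 𝕜) = φ.toLinearMap := by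
  refine ⟨⟨LinearMap.toMatrix' φ.toLinearMap, LinearMap.toMatrix' φ.symm.toLinearMap, ?_, ?_⟩, ?_⟩
  · rw [← LinearMap.toMatrix'_comp]; simp
  · rw [← LinearMap.toMatrix'_comp]; simp
  · exact Matrix.toLin'_toMatrix' _

theorem gl_toLin'_injective (g : GL (Fin n) 𝕜) :
    Function.Injective (Matrix.toLin' (g : Matrix (Fin n) (Fin n) 𝕜)) := by
  rw [Matrix.toLin'_apply']
  exact Matrix.mulVec_injective_of_isUnit g.isUnit

theorem Projectivization.submodule_gl_smul (g : GL (Fin n) 𝕜) (x : ℙ 𝕜 (Fin n → 𝕜)) :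
    (g • x).submodule =
      x.submodule.map (Matrix.toLin' (g : Matrix (Fin n) (Fin n) 𝕜)) := by
  induction x using Projectivization.ind with
  | h v hv =>
    rw [Projectivization.smul_mk, Projectivization.submodule_mk, Projectivization.submodule_mk,
      Submodule.map_span, Set.image_singleton]
    rfl

theorem Projectivization.eq_of_submodule_le {x y : ℙ 𝕜 (Fin n → 𝕜)}
    (h : x.submodule ≤ y.submodule) : x = y := by
  apply Projectivization.submodule_injective
  exact Submodule.eq_of_le_of_finrank_eq h (by simp [Projectivization.finrank_submodule])

theorem FlagVariety.smul_eq_self_iff {F : FlagVariety 𝕜 n m} {g : GL (Fin n) 𝕜} :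
    g • F = F ↔ ∀ i, (F i).submodule.map (Matrix.toLin' (g : Matrix (Fin n) (Fin n) 𝕜)) ≤
      (F i).submodule := by
  constructor
  · intro h i
    rw [← Projectivization.submodule_gl_smul]
    exact (congrArg Projectivization.submodule (congrFun h i)).le
  · intro h
    funext i
    apply Projectivization.eq_of_submodule_le
    rw [Pi.smul_apply, Projectivization.submodule_gl_smul]
    exact h i

namespace FlagVariety.IsAdapted

variable {F : FlagVariety 𝕜 n m} {σ ι κ : Type} {blk : ι → σ}
  {e : Module.Basis (ι ⊕ κ) 𝕜 (Fin n → 𝕜)}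

theorem map_le (hF : F.IsAdapted blk e) {h : Module.End 𝕜 (Fin n → 𝕜)} {c : σ → 𝕜}
    (hc : ∀ x, h (e (Sum.inl x)) = c (blk x) • e (Sum.inl x)) (i : Fin m) :
    (F i).submodule.map h ≤ (F i).submodule := by
  obtain ⟨s, hs⟩ := hF.exists_block i
  rintro _ ⟨v, hv, rfl⟩
  have : Set.EqOn h (c s • LinearMap.id : Module.End 𝕜 (Fin n → 𝕜))
      (Submodule.span 𝕜 ((fun x => e (Sum.inl x)) '' (blk ⁻¹' {s}))) := by
    apply LinearMap.eqOn_span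
    rintro _ ⟨x, rfl, rfl⟩
    simpa using hc x
  rw [this (hs hv)]
  exact Submodule.smul_mem _ _ hv

/-- A block contains a line, so it cannot be empty; this is what later forces the scalar of a block
to be non-zero. -/
theorem exists_blk_eq (hF : F.IsAdapted blk e) (s : σ) : ∃ x, blk x = s := by
  by_contra! hne
  obtain ⟨i, hi⟩ := hF.exists_line s
  have : blk ⁻¹' {s} = ∅ := Set.eq_empty_of_forall_notMem hne
  rw [this, Set.image_empty, Submodule.span_empty, le_bot_iff] at hi
  have h1 := (F i).finrank_submodule
  rw [hi, finrank_bot] at h1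
  exact zero_ne_one h1

theorem smul_eq_self_iff (hF : F.IsAdapted blk e) {g : GL (Fin n) 𝕜} :
    g • F = F ↔ ∃ c : σ → 𝕜, ∀ x, Matrix.toLin' (g : Matrix (Fin n) (Fin n) 𝕜) (e (Sum.inl x)) =
      c (blk x) • e (Sum.inl x) := by
  rw [FlagVariety.smul_eq_self_iff]
  exact ⟨hF.scalar _, fun ⟨c, hc⟩ => hF.map_le hc⟩

/-- Conjugation by `φ` transports the scalar property. This serves to move an adapted basis to the
standard one, and to recentre at an arbitrary point of an orbit. -/
theorem smul (hF : F.IsAdapted blk e) (g : GL (Fin n) 𝕜) (φ : (Fin n → 𝕜) ≃ₗ[𝕜] (Fin n → 𝕜))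
    (hφ : Matrix.toLin' (g : Matrix (Fin n) (Fin n) 𝕜) = φ.toLinearMap) :
    (g • F).IsAdapted blk (e.map φ) := by
  have hsub : ∀ i, ((g • F) i).submodule = (F i).submodule.map φ.toLinearMap := fun i => by
    rw [Pi.smul_apply, Projectivization.submodule_gl_smul, hφ]
  have hspan : ∀ s, Submodule.span 𝕜 ((fun x => e.map φ (Sum.inl x)) '' (blk ⁻¹' {s})) =
      (Submodule.span 𝕜 ((fun x => e (Sum.inl x)) '' (blk ⁻¹' {s}))).map φ.toLinearMap := fun s => by
    rw [Submodule.map_span, Set.image_image]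
    simp
  refine ⟨fun i => ?_, fun s => ?_, fun h hh => ?_⟩
  · obtain ⟨s, hs⟩ := hF.exists_block i
    refine ⟨s, ?_⟩
    rw [hsub, hspan]
    exact Submodule.map_mono hs
  · obtain ⟨i, hi⟩ := hF.exists_line s
    refine ⟨i, ?_⟩
    rw [hsub, hspan]
    exact Submodule.map_mono hi
  · obtain ⟨c, hc⟩ := hF.scalar (φ.symm.toLinearMap ∘ₗ h ∘ₗ φ.toLinearMap) (by
      rintro i _ ⟨v, hv, rfl⟩
      have h1 : h (φ v) ∈ ((g • F) i).submodule := by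
        refine hh i ⟨φ v, ?_, rfl⟩
        rw [hsub]
        exact ⟨v, hv, rfl⟩
      rw [hsub] at h1
      obtain ⟨w, hw, hwv⟩ := h1
      have : φ.symm (h (φ v)) = w := by rw [← hwv]; exact φ.symm_apply_apply w
      change φ.symm (h (φ v)) ∈ _
      rwa [this])
    refine ⟨c, fun x => ?_⟩
    have h1 : φ.symm (h (φ (e (Sum.inl x)))) = c (blk x) • e (Sum.inl x) := hc x
    rw [LinearEquiv.symm_apply_eq, map_smul] at h1
    simpa using h1

end FlagVariety.IsAdapted

end GeneralLinear

/-! ### The stabiliser as a block matrix group -/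

namespace SplittingType

variable {n m : ℕ} (p : SplittingType n m) {A B C : ℕ}
  (I : Fin A ≃ p.I) (J : Fin B ≃ p.J) (K : Fin C ≃ p.K)

/-- The row indices outside of the last block. -/
abbrev CoreIndex : Type :=
  Fin A ⊕ (Σ b : Fin B, Fin ((J b).1.card - 1)) ⊕ (Σ c : Fin C, Fin (K c).1.2)

/-- The row indices outside of the last block, sorted by the non-trivial summands. -/
def coreIndexEquiv : p.CoreIndex (A := A) J K ≃ Σ s : p.Core, Fin (p.coreDim s) :=
  (Equiv.sumCongr (I.trans (Equiv.sigmaUnique p.I fun _ => Fin 1).symm)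
    ((Equiv.sumCongr (Equiv.sigmaCongrLeft (β := fun b : p.J => Fin (b.1.card - 1)) J)
      (Equiv.sigmaCongrLeft (β := fun c : p.K => Fin c.1.2) K)).trans
        (Equiv.sumSigmaDistrib fun s : p.J ⊕ p.K => Fin (p.coreDim (Sum.inr s))).symm)).trans
    (Equiv.sumSigmaDistrib fun s : p.Core => Fin (p.coreDim s)).symm

/-- The non-trivial summand to which a row index belongs. -/
def coreBlock (x : p.CoreIndex (A := A) J K) : p.Core := (p.coreIndexEquiv I J K x).1

@[simp] theorem coreBlock_inl (a : Fin A) :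
    p.coreBlock I J K (Sum.inl a) = Sum.inl (I a) := rfl

@[simp] theorem coreBlock_inr_inl (b : Σ b : Fin B, Fin ((J b).1.card - 1)) :
    p.coreBlock I J K (Sum.inr (Sum.inl b)) = Sum.inr (Sum.inl (J b.1)) := rfl

@[simp] theorem coreBlock_inr_inr (c : Σ c : Fin C, Fin (K c).1.2) :
    p.coreBlock I J K (Sum.inr (Sum.inr c)) = Sum.inr (Sum.inr (K c.1)) := rfl

theorem exists_isAdapted_coreBlock {𝕜 : Type u} [Field 𝕜] {F : FlagVariety 𝕜 n m}
    (hF : p.Constructible F.toFlag) :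
    ∃ e : Module.Basis (BlockIndex p A J K) 𝕜 (Fin n → 𝕜),
      F.IsAdapted (p.coreBlock I J K) e :=
  hF.exists_isAdapted (Equiv.refl _) _ fun s =>
    ⟨((p.coreIndexEquiv I J K).subtypeEquiv fun _ => Iff.rfl).trans (Equiv.sigmaSubtype s)⟩

theorem fromBlocks_coreBlock_apply {𝕜 : Type u} [Field 𝕜] (c : p.Core → 𝕜) (d : Fin A → 𝕜)
    (e : Fin B → 𝕜) (f : Fin C → 𝕜) (hd : ∀ a, c (Sum.inl (I a)) = d a)
    (he : ∀ b, c (Sum.inr (Sum.inl (J b))) = e b) (hf : ∀ b, c (Sum.inr (Sum.inr (K b))) = f b)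
    (X : Matrix (p.CoreIndex (A := A) J K) (Fin (n - p.rank)) 𝕜)
    (Y : Matrix (Fin (n - p.rank)) (Fin (n - p.rank)) 𝕜) (y x) :
    Matrix.fromBlocks (Matrix.fromBlocks (Matrix.diagonal d) 0 0
      (Matrix.fromBlocks
        (Matrix.blockDiagonal' fun b =>
          e b • (1 : Matrix (Fin ((J b).1.card - 1)) (Fin ((J b).1.card - 1)) 𝕜)) 0 0
        (Matrix.blockDiagonal' fun c =>
          f c • (1 : Matrix (Fin (K c).1.2) (Fin (K c).1.2) 𝕜)))) X 0 Y y (Sum.inl x) =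
      if y = Sum.inl x then c (p.coreBlock I J K x) else 0 := by
  have h1 : ∀ {β : Type} [DecidableEq β] {k : β → ℕ} (a : β → 𝕜) (y x : Σ b, Fin (k b)),
      Matrix.blockDiagonal' (fun b => a b • (1 : Matrix (Fin (k b)) (Fin (k b)) 𝕜)) y x =
        if y = x then a x.1 else 0 := by
    rintro β _ k a ⟨b, j⟩ ⟨b', j'⟩
    by_cases hb : b = b'
    · subst hb
      simp [Matrix.one_apply]
    · rw [Matrix.blockDiagonal'_apply_ne _ _ _ hb, if_neg (fun h => hb (congrArg Sigma.fst h))]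
  rcases y with (a | b | b) | k <;> rcases x with a' | b' | b' <;>
    simp [Matrix.diagonal_apply, h1, hd, he, hf]
  by_cases h : a = a' <;> simp [h]

/-- Only the columns outside of the last block are constrained, and there the condition is that of
acting by one scalar on each block. -/
theorem mem_blockGroup_iff {𝕜 : Type u} [Field 𝕜] (hI : ∀ s, ∃ x, p.coreBlock I J K x = s)
    (g : GL (Fin n) 𝕜) : g ∈ blockGroup 𝕜 p I J K ↔ ∃ c : p.Core → 𝕜, ∀ y x,
      g (blockEquiv p I J K y) (blockEquiv p I J K (Sum.inl x)) =
        if y = Sum.inl x then c (p.coreBlock I J K x) else 0 := by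
  have hre : ∀ M : Matrix (BlockIndex p A J K) (BlockIndex p A J K) 𝕜,
      (g : Matrix (Fin n) (Fin n) 𝕜) =
        Matrix.reindex (blockEquiv p I J K) (blockEquiv p I J K) M ↔
      ∀ y x, g (blockEquiv p I J K y) (blockEquiv p I J K x) = M y x := by
    intro M
    rw [← Equiv.symm_apply_eq, ← Matrix.ext_iff]
    rfl
  simp only [blockGroup, Set.mem_ofPred_eq, hre]
  constructor
  · rintro ⟨d, e, f, X, Y, h⟩
    refine ⟨Sum.elim (fun a => d (I.symm a)) (Sum.elim (fun b => e (J.symm b))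
      fun c => f (K.symm c)), fun y x => ?_⟩
    rw [h]
    exact p.fromBlocks_coreBlock_apply I J K _ _ _ _ (by simp) (by simp) (by simp) X Y y x
  · rintro ⟨c, h⟩
    -- A vanishing scalar would give a zero column of an invertible matrix.
    have hc : ∀ s, c s ≠ 0 := by
      intro s h0
      obtain ⟨x, rfl⟩ := hI s
      have : Matrix.toLin' (g : Matrix (Fin n) (Fin n) 𝕜)
          (Pi.single (blockEquiv p I J K (Sum.inl x)) 1) = 0 := by
        funext k
        obtain ⟨y, rfl⟩ := (blockEquiv p I J K).surjective k
        rw [Matrix.toLin'_apply, Matrix.mulVec_single_one, Matrix.col_apply, h, h0]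
        simp
      have := gl_toLin'_injective g (this.trans (map_zero _).symm)
      simpa using congrFun this (blockEquiv p I J K (Sum.inl x))
    refine ⟨fun a => Units.mk0 _ (hc (Sum.inl (I a))),
      fun b => Units.mk0 _ (hc (Sum.inr (Sum.inl (J b)))),
      fun c => Units.mk0 _ (hc (Sum.inr (Sum.inr (K c)))),
      fun y x => g (blockEquiv p I J K (Sum.inl y)) (blockEquiv p I J K (Sum.inr x)),
      fun y x => g (blockEquiv p I J K (Sum.inr y)) (blockEquiv p I J K (Sum.inr x)),
      fun y x => ?_⟩
    rcases x with x | k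
    · rw [h]
      exact (p.fromBlocks_coreBlock_apply I J K c _ _ _ (fun _ => rfl) (fun _ => rfl)
        (fun _ => rfl) _ _ y x).symm
    · rcases y with y | y <;> rfl

/-- The required `g` carries an adapted basis to the standard basis, ordered by `blockEquiv`. -/
theorem exists_smul_stabilizer_eq_blockGroup {𝕜 : Type u} [Field 𝕜] {F : FlagVariety 𝕜 n m}
    (hF : p.Constructible F.toFlag) : ∃ g : GL (Fin n) 𝕜,
      (MulAction.stabilizer (GL (Fin n) 𝕜) (g • F) : Set (GL (Fin n) 𝕜)) =
        blockGroup 𝕜 p I J K := by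
  obtain ⟨e, he⟩ := p.exists_isAdapted_coreBlock I J K hF
  let φ := e.equiv (Pi.basisFun 𝕜 (Fin n)) (blockEquiv p I J K)
  obtain ⟨g, hg⟩ := exists_gl_toLin'_eq φ
  refine ⟨g, ?_⟩
  have hgF := he.smul g φ hg
  ext g'
  rw [SetLike.mem_coe, MulAction.mem_stabilizer_iff, hgF.smul_eq_self_iff,
    p.mem_blockGroup_iff I J K he.exists_blk_eq]
  refine exists_congr fun c => ?_
  rw [forall_comm]
  refine forall_congr' fun x => ?_
  rw [funext_iff, ← (blockEquiv p I J K).forall_congr_right]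
  refine forall_congr' fun y => ?_
  simp [φ, Pi.single_apply, Matrix.toLin'_apply]

end SplittingType

/-! ### Tools for local parametrizations -/

/-- A linear system depending differentiably on a parameter, with a trivial kernel at one parameter
value, has nearby at most one solution, which depends differentiably on the parameter. -/
theorem exists_differentiableOn_solution {𝕜 : Type*} [RCLike 𝕜] {N E F : Type*}
    [NormedAddCommGroup N] [NormedSpace 𝕜 N] [FiniteDimensional 𝕜 N]
    [NormedAddCommGroup E] [NormedSpace 𝕜 E]
    [NormedAddCommGroup F] [NormedSpace 𝕜 F] [FiniteDimensional 𝕜 F]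
    {a : E → N →L[𝕜] F} {b : E → F} (ha : Differentiable 𝕜 a) (hb : Differentiable 𝕜 b) {x : E}
    (hx : ∀ u, a x u = 0 → u = 0) :
    ∃ (V : Set E) (ρ : E → N), IsOpen V ∧ x ∈ V ∧ DifferentiableOn 𝕜 ρ V ∧
      ∀ z ∈ V, ∀ u, a z u = b z → u = ρ z := by
  have : CompleteSpace N := FiniteDimensional.complete 𝕜 N
  obtain ⟨l, hl⟩ := LinearMap.exists_leftInverse_of_injective (a x).toLinearMap
    (LinearMap.ker_eq_bot'.2 hx)
  let L : F →L[𝕜] N := LinearMap.toContinuousLinearMap l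
  -- With `L` a left inverse of `a x`, the map `T z` is the identity at `z = x`, hence invertible
  -- nearby; then `a z u = b z` forces `u = (T z)⁻¹ (L (b z))`.
  let T : E → N →L[𝕜] N := fun z => L.comp (a z)
  have hT : Differentiable 𝕜 T := fun z => (differentiableAt_const L).clm_comp (ha z)
  have hTx : T x = 1 := by
    ext u
    exact LinearMap.congr_fun hl u
  refine ⟨{z | IsUnit (T z)}, fun z => Ring.inverse (T z) (L (b z)),
    Units.isOpen.preimage hT.continuous, ?_, fun z hz => ?_, fun z hz u hu => ?_⟩
  · change IsUnit (T x)
    rw [hTx]; exact isUnit_one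
  · have h1 : DifferentiableAt 𝕜 (fun z => Ring.inverse (T z)) z :=
      (differentiableAt_inverse hz).comp z (hT z)
    exact (h1.clm_apply (L.differentiableAt.comp z (hb z))).differentiableWithinAt
  · change u = Ring.inverse (T z) (L (b z))
    have h1 : Ring.inverse (T z) * T z = 1 := Ring.inverse_mul_cancel _ hz
    have h2 : (Ring.inverse (T z)) (T z u) = u := congrArg (fun S : N →L[𝕜] N => S u) h1
    rw [← hu]
    exact h2.symm

/-- Mutually inverse maps on open sets give a local parametrization of a submanifold. -/
theorem exists_parametrization {𝕜 : Type*} [RCLike 𝕜] {E : Type*} [NormedAddCommGroup E]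
    [NormedSpace 𝕜 E] {M : Set E} {d : ℕ} {x : E} {V : Set E} {ρ : E → Fin d → 𝕜}
    {θ : (Fin d → 𝕜) → E} {W : Set (Fin d → 𝕜)} (hV : IsOpen V) (hxV : x ∈ V)
    (hρ : DifferentiableOn 𝕜 ρ V) (hW : IsOpen W) (hxW : ρ x ∈ W) (hθ : ContDiffOn 𝕜 ω θ W)
    (hM : ∀ t ∈ W, θ t ∈ M) (hρθ : ∀ t ∈ W, θ t ∈ V → ρ (θ t) = t)
    (hθρ : ∀ z ∈ M, z ∈ V → θ (ρ z) = z) :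
    ∃ U : Set E, IsOpen U ∧ x ∈ U ∧
      ∃ (W : Set (Fin d → 𝕜)) (θ : (Fin d → 𝕜) → E) (ρ : E → (Fin d → 𝕜)),
        IsOpen W ∧ ContDiffOn 𝕜 ω θ W ∧ (∀ w ∈ W, Function.Injective (fderiv 𝕜 θ w)) ∧
        Set.BijOn θ W (M ∩ U) ∧ Set.LeftInvOn ρ θ W ∧ ContinuousOn ρ (M ∩ U) := by
  have hWo : IsOpen (W ∩ θ ⁻¹' V) := hθ.continuousOn.isOpen_inter_preimage hW hV
  refine ⟨V ∩ ρ ⁻¹' W, hρ.continuousOn.isOpen_inter_preimage hV hW, ⟨hxV, hxW⟩, W ∩ θ ⁻¹' V, θ, ρ,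
    hWo, hθ.mono Set.inter_subset_left, fun w hw => ?_, ⟨?_, ?_, ?_⟩, fun t ht => hρθ t ht.1 ht.2,
    hρ.continuousOn.mono (Set.inter_subset_right.trans Set.inter_subset_left)⟩
  · have h1 : HasFDerivAt θ (fderiv 𝕜 θ w) w :=
      (((hθ.differentiableOn (by simp)) w hw.1).differentiableAt
        (hW.mem_nhds hw.1)).hasFDerivAt
    have h2 : HasFDerivAt ρ (fderiv 𝕜 ρ (θ w)) (θ w) :=
      ((hρ _ hw.2).differentiableAt (hV.mem_nhds hw.2)).hasFDerivAt
    -- The chain rule for `ρ ∘ θ = id` gives a left inverse of the derivative of `θ`.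
    have h3 : HasFDerivAt id ((fderiv 𝕜 ρ (θ w)).comp (fderiv 𝕜 θ w)) w := by
      refine (h2.comp w h1).congr_of_eventuallyEq ?_
      filter_upwards [hWo.mem_nhds hw] with t ht using (hρθ t ht.1 ht.2).symm
    have h4 := h3.unique (hasFDerivAt_id w)
    refine Function.LeftInverse.injective (g := fderiv 𝕜 ρ (θ w)) fun t => ?_
    exact congrArg (fun S : (Fin d → 𝕜) →L[𝕜] (Fin d → 𝕜) => S t) h4
  · rintro t ⟨htW, htV⟩
    refine ⟨hM t htW, htV, ?_⟩
    rw [Set.mem_preimage, hρθ t htW htV]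
    exact htW
  · rintro t ⟨htW, htV⟩ t' ⟨htW', htV'⟩ h
    rw [← hρθ t htW htV, h, hρθ t' htW' htV']
  · rintro z ⟨hzM, hzV, hzW⟩
    refine ⟨ρ z, ⟨hzW, ?_⟩, hθρ z hzM hzV⟩
    rw [Set.mem_preimage, hθρ z hzM hzV]
    exact hzV

/-! ### Normalised representatives in affine charts -/

section AffineChart

variable {𝕜 : Type u} [Field 𝕜] {n : ℕ}

/-- The representative of a point of the `j`-th affine chart whose `j`-th entry is `1`. -/
def affineVec (j : Fin n) (z : {k : Fin n // k ≠ j} → 𝕜) : Fin n → 𝕜 :=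
  fun k => if h : k = j then 1 else z ⟨k, h⟩

@[simp] theorem affineVec_self (j : Fin n) (z : {k : Fin n // k ≠ j} → 𝕜) :
    affineVec j z j = 1 := by simp [affineVec]

@[simp] theorem affineVec_coe (j : Fin n) (z : {k : Fin n // k ≠ j} → 𝕜)
    (k : {k : Fin n // k ≠ j}) : affineVec j z k = z k := by simp [affineVec, k.2]

theorem affineVec_ne_zero (j : Fin n) (z : {k : Fin n // k ≠ j} → 𝕜) : affineVec j z ≠ 0 :=
  fun h => by simpa using congrFun h j

theorem affineChart_eq_mk (j : Fin n) (z : {k : Fin n // k ≠ j} → 𝕜) :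
    affineChart j z = Projectivization.mk 𝕜 (affineVec j z) (affineVec_ne_zero j z) := rfl

theorem submodule_affineChart (j : Fin n) (z : {k : Fin n // k ≠ j} → 𝕜) :
    (affineChart j z).submodule = Submodule.span 𝕜 {affineVec j z} :=
  Projectivization.submodule_mk _ _

theorem smul_affineVec_div {j : Fin n} {w : Fin n → 𝕜} (hw : w j ≠ 0) :
    w j • affineVec j (fun k => w k / w j) = w := by
  funext k
  by_cases hk : k = j
  · subst hk; simp
  · have := affineVec_coe j (fun k => w k / w j) ⟨k, hk⟩
    simp only at this
    rw [Pi.smul_apply, this, smul_eq_mul, mul_div_cancel₀ _ hw]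

theorem gl_smul_affineChart_eq_iff {j : Fin n} {z z' : {k : Fin n // k ≠ j} → 𝕜}
    {g : GL (Fin n) 𝕜} : g • affineChart j z = affineChart j z' ↔
      ∃ a : 𝕜, a ≠ 0 ∧
        Matrix.toLin' (g : Matrix (Fin n) (Fin n) 𝕜) (affineVec j z) = a • affineVec j z' := by
  rw [affineChart_eq_mk, affineChart_eq_mk, Projectivization.smul_mk, Projectivization.mk_eq_mk_iff]
  constructor
  · rintro ⟨a, ha⟩
    exact ⟨a, a.ne_zero, ha.symm⟩
  · rintro ⟨a, ha, h⟩
    exact ⟨Units.mk0 a ha, h.symm⟩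

end AffineChart

/-! ### Local parametrization of an orbit -/

section Orbit

/-- The product of the standard affine charts of `(ℙⁿ⁻¹)ᵐ` with indices `j i`. -/
abbrev ChartProduct (𝕜 : Type u) {n m : ℕ} (j : Fin m → Fin n) : Type u :=
  (i : Fin m) → {k : Fin n // k ≠ j i} → 𝕜

variable {𝕜 : Type u} [RCLike 𝕜] {n m d : ℕ}

/-- A linear family `1 + Q t` of endomorphisms, which is transversal to the stabiliser of a tuple of
lines and meets all group elements which do not leave the chart up to rescaling, parametrizes the
orbit of the tuple. -/
theorem exists_orbit_parametrization (j : Fin m → Fin n)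
    (x : ChartProduct 𝕜 j) (Q : (Fin d → 𝕜) →ₗ[𝕜] Module.End 𝕜 (Fin n → 𝕜))
    (hinj : ∀ t, (∀ i, Q t (affineVec (j i) (x i)) ∈ Submodule.span 𝕜 {affineVec (j i) (x i)}) →
      t = 0)
    (hsurj : ∀ g : Module.End 𝕜 (Fin n → 𝕜), (∀ i, g (affineVec (j i) (x i)) (j i) ≠ 0) →
      ∃ t, ∀ i, ∃ a : 𝕜, a ≠ 0 ∧
        affineVec (j i) (x i) + Q t (affineVec (j i) (x i)) = a • g (affineVec (j i) (x i))) :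
    let M := {z : ChartProduct 𝕜 j | (fun i => affineChart (j i) (z i)) ∈
      MulAction.orbit (GL (Fin n) 𝕜) (fun i => affineChart (𝕜 := 𝕜) (j i) (x i))}
    ∃ U : Set (ChartProduct 𝕜 j), IsOpen U ∧ x ∈ U ∧
      ∃ (W : Set (Fin d → 𝕜)) (θ : (Fin d → 𝕜) → ChartProduct 𝕜 j)
        (ρ : ChartProduct 𝕜 j → (Fin d → 𝕜)),
        IsOpen W ∧ ContDiffOn 𝕜 ω θ W ∧ (∀ w ∈ W, Function.Injective (fderiv 𝕜 θ w)) ∧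
        Set.BijOn θ W (M ∩ U) ∧ Set.LeftInvOn ρ θ W ∧ ContinuousOn ρ (M ∩ U) := by
  intro M
  let v : Fin m → Fin n → 𝕜 := fun i => affineVec (j i) (x i)
  have hv1 : ∀ i, v i (j i) = 1 := fun i => affineVec_self _ _
  have hv : ∀ i (k : {k // k ≠ j i}), v i k = x i k := fun i => affineVec_coe _ _
  let A : (Fin d → 𝕜) →ₗ[𝕜] ChartProduct 𝕜 j :=
    { toFun := fun t i k => Q t (v i) k
      map_add' := fun t t' => by ext i k; simp
      map_smul' := fun c t => by ext i k; simp }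
  let B : ChartProduct 𝕜 j →ₗ[𝕜] (Fin d → 𝕜) →ₗ[𝕜] ChartProduct 𝕜 j :=
    LinearMap.mk₂ 𝕜 (fun z t i k => Q t (v i) (j i) * z i k)
      (fun z z' t => by ext i k; simp [mul_add])
      (fun c z t => by ext i k; simp [mul_left_comm])
      (fun z t t' => by ext i k; simp [add_mul])
      (fun c z t => by ext i k; simp [mul_assoc])
  let G : ChartProduct 𝕜 j →L[𝕜] (Fin d → 𝕜) →L[𝕜] ChartProduct 𝕜 j :=
    LinearMap.toContinuousLinearMap (LinearMap.toContinuousLinearMap.toLinearMap ∘ₗ B)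
  -- Proportionality of `v i + Q t (v i)` to `affineVec (j i) (z i)` becomes, after eliminating the
  -- factor by means of entry `j i`, the equation `a z t = z - x`, which is linear in `t`.
  let a : ChartProduct 𝕜 j → (Fin d → 𝕜) →L[𝕜] ChartProduct 𝕜 j := fun z =>
    LinearMap.toContinuousLinearMap A - G z
  have haz : ∀ z t i k, a z t i k = Q t (v i) k - Q t (v i) (j i) * z i k := fun _ _ _ _ => rfl
  have hsol : ∀ z t, (∀ i, ∀ k : {k // k ≠ j i},
      v i k + Q t (v i) k = (v i (j i) + Q t (v i) (j i)) * z i k) → a z t = z - x := by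
    intro z t h
    funext i k
    rw [haz, Pi.sub_apply, Pi.sub_apply, ← hv]
    have := h i k
    rw [hv1] at this
    linear_combination this
  -- The kernel at `z = x` consists of the `t` for which `Q t` preserves all the lines; it vanishes
  -- by `hinj`.
  obtain ⟨V, ρ, hVo, hxV, hρ, huniq⟩ := exists_differentiableOn_solution (a := a)
    (b := fun z => z - x) ((differentiable_const _).sub G.differentiable)
    (differentiable_id.sub_const x) (x := x) (fun t ht => hinj t fun i => by
      rw [Submodule.mem_span_singleton]
      refine ⟨Q t (v i) (j i), ?_⟩
      funext k
      by_cases hk : k = j i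
      · subst hk; simp [v]
      · have h1 := haz x t i ⟨k, hk⟩
        rw [ht, ← hv] at h1
        change Q t (v i) (j i) * v i k = Q t (v i) k
        change (0 : 𝕜) = Q t (v i) k - Q t (v i) (j i) * v i k at h1
        linear_combination h1)
  let w : (Fin d → 𝕜) → Fin m → Fin n → 𝕜 := fun t i => v i + Q t (v i)
  have hwc : ∀ i k, ContDiff 𝕜 ω fun t => w t i k := by
    intro i k
    let q : (Fin d → 𝕜) →ₗ[𝕜] 𝕜 :=
      { toFun := fun t => Q t (v i) k
        map_add' := fun t t' => by simp
        map_smul' := fun c t => by simp }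
    exact contDiff_const.add (LinearMap.toContinuousLinearMap q).contDiff
  let D : (Fin d → 𝕜) → 𝕜 := fun t => LinearMap.det (1 + Q t)
  have hD : Continuous D := by
    have : D = fun t => (LinearMap.toMatrix' (1 + Q t)).det := by
      funext t; exact (LinearMap.det_toMatrix' _).symm
    rw [this]
    refine Continuous.matrix_det ?_
    let q : (Fin d → 𝕜) →ₗ[𝕜] Matrix (Fin n) (Fin n) 𝕜 := LinearMap.toMatrix'.toLinearMap ∘ₗ Q
    have : (fun t => LinearMap.toMatrix' (1 + Q t)) = fun t => LinearMap.toMatrix' 1 + q t := by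
      funext t; simp [q]
    rw [this]
    exact continuous_const.add q.continuous_of_finiteDimensional
  let θ : (Fin d → 𝕜) → ChartProduct 𝕜 j := fun t i k => w t i k / w t i (j i)
  -- The first condition puts `1 + Q t` in the general linear group, the second keeps the moved
  -- lines in the chart.
  let W : Set (Fin d → 𝕜) := {t | D t ≠ 0 ∧ ∀ i, w t i (j i) ≠ 0}
  have hWo : IsOpen W := by
    have : W = {t | D t ≠ 0} ∩ ⋂ i, {t | w t i (j i) ≠ 0} := by
      ext t; simp [W]
    rw [this]
    exact (isOpen_ne_fun hD continuous_const).inter (isOpen_iInter_of_finite fun i =>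
      isOpen_ne_fun (hwc i (j i)).continuous continuous_const)
  have hρx : ρ x = 0 := by
    refine (huniq x hxV 0 ?_).symm
    simp
  have hwθ : ∀ t ∈ W, ∀ i, w t i (j i) • affineVec (j i) (θ t i) = w t i := fun t ht i =>
    smul_affineVec_div (ht.2 i)
  refine exists_parametrization hVo hxV hρ hWo ?_ (θ := θ) ?_ ?_ ?_ ?_
  · rw [hρx]
    refine ⟨by simp [D], fun i => ?_⟩
    simp [w, hv1]
  · refine contDiffOn_pi.2 fun i => contDiffOn_pi.2 fun k => ?_
    exact (hwc i k).contDiffOn.div (hwc i (j i)).contDiffOn fun t ht => ht.2 i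
  · intro t ht
    obtain ⟨g, hg⟩ := exists_gl_toLin'_eq
      (LinearEquiv.ofIsUnitDet (f := 1 + Q t) (v := Pi.basisFun 𝕜 (Fin n))
        (v' := Pi.basisFun 𝕜 (Fin n)) (by rw [LinearMap.det_toMatrix]; exact ht.1.isUnit))
    refine ⟨g, ?_⟩
    funext i
    refine gl_smul_affineChart_eq_iff.2 ⟨_, ht.2 i, ?_⟩
    rw [hwθ t ht, hg]
    rfl
  · intro t ht htV
    refine (huniq _ htV t (hsol _ _ fun i k => ?_)).symm
    exact (mul_div_cancel₀ _ (ht.2 i)).symm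
  · rintro z ⟨g, hg⟩ hzV
    have hg' : ∀ i, ∃ b : 𝕜, b ≠ 0 ∧ Matrix.toLin' (g : Matrix (Fin n) (Fin n) 𝕜) (v i) =
        b • affineVec (j i) (z i) := fun i =>
      gl_smul_affineChart_eq_iff.1 (congrFun hg i)
    choose b hb hgv using hg'
    -- As `z` is in the chart, `g` may be replaced by some `1 + Q t` inducing the same tuple;
    -- uniqueness of the solution then identifies `t` with `ρ z`.
    obtain ⟨t, ht⟩ := hsurj (Matrix.toLin' (g : Matrix (Fin n) (Fin n) 𝕜)) fun i => by
      change Matrix.toLin' (g : Matrix (Fin n) (Fin n) 𝕜) (v i) (j i) ≠ 0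
      rw [hgv]
      simpa using hb i
    choose c hc hct using ht
    have hwt : ∀ i, w t i = (c i * b i) • affineVec (j i) (z i) := fun i => by
      rw [mul_smul, ← hgv]
      exact hct i
    have hwj : ∀ i, w t i (j i) = c i * b i := fun i => by simp [hwt]
    have hwk : ∀ i (k : {k // k ≠ j i}), w t i k = w t i (j i) * z i k := fun i k => by
      rw [hwj, hwt]
      simp
    rw [← huniq z hzV t (hsol z t hwk)]
    funext i k
    change w t i k / w t i (j i) = z i k
    rw [hwk, mul_div_cancel_left₀]
    rw [hwj]
    exact mul_ne_zero (hc i) (hb i)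

end Orbit

/-! ### The transversal family and the dimension count -/

section Dimension

variable {𝕜 : Type u} [RCLike 𝕜] {n m : ℕ} {σ ι κ : Type} {blk : ι → σ}

/-- The family consists of the maps that vanish on the remainder of the basis and satisfy one linear
normalisation per block. The normalisations are independent and remove exactly the block scalars,
hence the count `d = n * #ι - #σ`. -/
theorem FlagVariety.IsAdapted.exists_linear_family [Fintype σ] [Fintype ι] (j : Fin m → Fin n)
    (x : ChartProduct 𝕜 j) {e : Module.Basis (ι ⊕ κ) 𝕜 (Fin n → 𝕜)}
    (he : FlagVariety.IsAdapted (fun i => affineChart (j i) (x i)) blk e) {d : ℕ}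
    (hd : d + Fintype.card σ = n * Fintype.card ι) :
    ∃ Q : (Fin d → 𝕜) →ₗ[𝕜] Module.End 𝕜 (Fin n → 𝕜),
      (∀ t, (∀ i, Q t (affineVec (j i) (x i)) ∈ Submodule.span 𝕜 {affineVec (j i) (x i)}) →
        t = 0) ∧
      ∀ g : Module.End 𝕜 (Fin n → 𝕜), (∀ i, g (affineVec (j i) (x i)) (j i) ≠ 0) →
        ∃ t, ∀ i, ∃ a : 𝕜, a ≠ 0 ∧
          affineVec (j i) (x i) + Q t (affineVec (j i) (x i)) = a • g (affineVec (j i) (x i)) := by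
  let v : Fin m → Fin n → 𝕜 := fun i => affineVec (j i) (x i)
  have hv1 : ∀ i, v i (j i) = 1 := fun i => affineVec_self _ _
  have hsub : ∀ i, (affineChart (j i) (x i)).submodule = Submodule.span 𝕜 {v i} := fun i =>
    submodule_affineChart _ _
  have hvmem : ∀ i, v i ∈ (affineChart (j i) (x i)).submodule := fun i => by
    rw [hsub]; exact Submodule.mem_span_singleton_self _
  choose r hr using he.exists_line
  choose q hq using he.exists_block
  have heq : ∀ (φ ψ : Module.End 𝕜 (Fin n → 𝕜)) s,
      (∀ y, blk y = s → φ (e (Sum.inl y)) = ψ (e (Sum.inl y))) → ∀ i,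
      (affineChart (j i) (x i)).submodule ≤
        Submodule.span 𝕜 ((fun x => e (Sum.inl x)) '' (blk ⁻¹' {s})) → φ (v i) = ψ (v i) := by
    intro φ ψ s h i hi
    refine LinearMap.eqOn_span (s := (fun x => e (Sum.inl x)) '' (blk ⁻¹' {s})) ?_ (hi (hvmem i))
    rintro _ ⟨y, hy, rfl⟩
    exact h y hy
  let H : (ι → Fin n → 𝕜) →ₗ[𝕜] Module.End 𝕜 (Fin n → 𝕜) :=
    (e.constr 𝕜).toLinearMap ∘ₗ
      { toFun := fun u => Sum.elim u 0
        map_add' := fun u u' => by ext (y | y) <;> simp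
        map_smul' := fun c u => by ext (y | y) <;> simp }
  have hH : ∀ u y, H u (e (Sum.inl y)) = u y := fun u y => by simp [H]
  -- In each block a line `r s` is selected. Its representative has entry `1` at `j (r s)`, so `ℓ`
  -- sends a map that is scalar on every block to the tuple of its scalars.
  let ℓ : (ι → Fin n → 𝕜) →ₗ[𝕜] (σ → 𝕜) :=
    { toFun := fun u s => H u (v (r s)) (j (r s))
      map_add' := fun u u' => by ext s; simp
      map_smul' := fun c u => by ext s; simp }
  have hℓ : ∀ u s, ℓ u s = H u (v (r s)) (j (r s)) := fun _ _ => rfl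
  have hℓs : Function.Surjective ℓ := by
    intro c
    refine ⟨fun y => c (blk y) • e (Sum.inl y), funext fun s => ?_⟩
    rw [hℓ, heq _ (c s • LinearMap.id) s (by rintro y rfl; simp [hH]) (r s) (hr s)]
    simp [hv1]
  have hfin : Module.finrank 𝕜 (LinearMap.ker ℓ) = d := by
    have h1 := ℓ.finrank_range_add_finrank_ker
    rw [LinearMap.range_eq_top.2 hℓs, finrank_top, Module.finrank_fintype_fun_eq_card] at h1
    have h2 : Module.finrank 𝕜 (ι → Fin n → 𝕜) = n * Fintype.card ι := by
      simp [Module.finrank_pi_fintype, mul_comm]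
    omega
  let f : (Fin d → 𝕜) ≃ₗ[𝕜] LinearMap.ker ℓ := LinearEquiv.ofFinrankEq _ _ (by simp [hfin])
  refine ⟨H ∘ₗ (LinearMap.ker ℓ).subtype ∘ₗ f.toLinearMap, fun t ht => ?_, fun g hg => ?_⟩
  · obtain ⟨c, hc⟩ := he.scalar (H (f t)) (fun i => by
      rw [hsub, Submodule.map_span_le]
      rintro _ rfl
      exact ht i)
    have hc0 : ∀ s, c s = 0 := by
      intro s
      have h1 : ℓ (f t) s = 0 := congrFun (f t).2 s
      rw [hℓ, heq _ (c s • LinearMap.id) s (by rintro y rfl; simp [hc]) (r s) (hr s)] at h1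
      simpa [hv1] using h1
    refine (LinearEquiv.map_eq_zero_iff f).1 (Subtype.ext (funext fun y => ?_))
    rw [← hH (f t) y, hc, hc0, zero_smul]
    rfl
  · let a : σ → 𝕜 := fun s => (g (v (r s)) (j (r s)))⁻¹
    let u : ι → Fin n → 𝕜 := fun y => a (blk y) • g (e (Sum.inl y)) - e (Sum.inl y)
    have hu : ∀ s i, (affineChart (j i) (x i)).submodule ≤
        Submodule.span 𝕜 ((fun x => e (Sum.inl x)) '' (blk ⁻¹' {s})) →
        H u (v i) = a s • g (v i) - v i := fun s i hi => by
      rw [heq (H u) (a s • g - LinearMap.id) s (by rintro y rfl; simp [hH, u]) i hi]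
      simp
    have hker : ℓ u = 0 := by
      funext s
      rw [hℓ, hu s (r s) (hr s)]
      have h1 : (g (v (r s)) (j (r s)))⁻¹ * g (v (r s)) (j (r s)) = 1 := inv_mul_cancel₀ (hg (r s))
      simp [a, hv1, h1]
    refine ⟨f.symm ⟨u, hker⟩, fun i => ⟨a (q i), inv_ne_zero (hg _), ?_⟩⟩
    simp only [LinearMap.comp_apply, LinearEquiv.coe_coe, LinearEquiv.apply_symm_apply,
      Submodule.subtype_apply]
    have := hu (q i) i (hq i)
    change v i + H u (v i) = a (q i) • g (v i)
    rw [this]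
    abel

/-- Any point of the orbit is a translate of `F`, so it has an adapted basis with the same blocks
and can serve as the base point of a parametrization. -/
theorem FlagVariety.IsAdapted.hasDimension_orbit [Fintype σ] [Fintype ι] {F : FlagVariety 𝕜 n m}
    {e : Module.Basis (ι ⊕ κ) 𝕜 (Fin n → 𝕜)} (he : F.IsAdapted blk e) {d : ℕ}
    (hd : d + Fintype.card σ = n * Fintype.card ι) :
    HasDimension (MulAction.orbit (GL (Fin n) 𝕜) F) d := by
  intro j x hx
  obtain ⟨g, hg⟩ := hx
  obtain ⟨e', he'⟩ : ∃ e', FlagVariety.IsAdapted (fun i => affineChart (j i) (x i)) blk e' := by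
    have h1 := he.smul g (LinearEquiv.ofBijective _
      ⟨gl_toLin'_injective g, LinearMap.injective_iff_surjective.1 (gl_toLin'_injective g)⟩) rfl
    rw [show g • F = _ from hg] at h1
    exact ⟨_, h1⟩
  obtain ⟨Q, hQ1, hQ2⟩ := he'.exists_linear_family j x hd
  have h1 := exists_orbit_parametrization j x Q hQ1 hQ2
  have h2 : MulAction.orbit (GL (Fin n) 𝕜) (fun i => affineChart (𝕜 := 𝕜) (j i) (x i)) =
      MulAction.orbit (GL (Fin n) 𝕜) F := MulAction.orbit_eq_iff.2 ⟨g, hg⟩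
  rw [h2] at h1
  exact h1

end Dimension

/-! ### Proof of the three claims -/

namespace SplittingType

theorem exists_mem_constructible_orbit {𝕜 : Type u} [Field 𝕜] {n m : ℕ} {p : SplittingType n m}
    {O : MulAction.orbitRel.Quotient (GL (Fin n) 𝕜) (FlagVariety 𝕜 n m)} (hO : O ∈ p.fibre 𝕜) :
    ∃ F, p.Constructible F.toFlag ∧ O.orbit = MulAction.orbit (GL (Fin n) 𝕜) F := by
  obtain ⟨F, hF, hc⟩ := hO
  refine ⟨F, hc, ?_⟩
  rw [MulAction.orbitRel.Quotient.mem_orbit] at hF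
  rw [← hF]
  exact MulAction.orbitRel.Quotient.orbit_mk F

end SplittingType

theorem mainTheorem3 {𝕜 : Type*} [RCLike 𝕜] (n m : ℕ) (hn : 2 ≤ n) (hm : 1 ≤ m)
    (p : SplittingType n m) (A B C : ℕ) (I : Fin A ≃ p.I) (J : Fin B ≃ p.J) (K : Fin C ≃ p.K) :
    (∀ O ∈ p.fibre 𝕜, ∃ F ∈ O.orbit,
      (MulAction.stabilizer (GL (Fin n) 𝕜) F : Set (GL (Fin n) 𝕜)) = blockGroup 𝕜 p I J K) ∧
    (∀ O ∈ p.fibre 𝕜, ∀ O' ∈ p.fibre 𝕜, ∀ F ∈ O.orbit, ∀ F' ∈ O'.orbit, ∃ g : GL (Fin n) 𝕜,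
      MulAction.stabilizer (GL (Fin n) 𝕜) F' =
        (MulAction.stabilizer (GL (Fin n) 𝕜) F).map (MulAut.conj g).toMonoidHom) ∧
    ∃ d : ℕ, (d : ℤ) = n * p.rank - A - B - C ∧ ∀ O ∈ p.fibre 𝕜, HasDimension O.orbit d := by
  have key : ∀ O ∈ p.fibre 𝕜, ∃ F, O.orbit = MulAction.orbit (GL (Fin n) 𝕜) F ∧
      (MulAction.stabilizer (GL (Fin n) 𝕜) F : Set (GL (Fin n) 𝕜)) = blockGroup 𝕜 p I J K := by
    intro O hO
    obtain ⟨F, hF, hFO⟩ := SplittingType.exists_mem_constructible_orbit hO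
    obtain ⟨g, hg⟩ := p.exists_smul_stabilizer_eq_blockGroup I J K hF
    exact ⟨g • F, by rw [hFO, MulAction.orbit_smul], hg⟩
  refine ⟨fun O hO => ?_, fun O hO O' hO' F hF F' hF' => ?_, ?_⟩
  · obtain ⟨F, hFO, hF⟩ := key O hO
    exact ⟨F, hFO ▸ MulAction.mem_orbit_self F, hF⟩
  · obtain ⟨F₁, hFO₁, hF₁⟩ := key O hO
    obtain ⟨F₂, hFO₂, hF₂⟩ := key O' hO'
    rw [hFO₁] at hF
    rw [hFO₂] at hF'
    obtain ⟨g, rfl⟩ := hF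
    obtain ⟨g', rfl⟩ := hF'
    have h12 : MulAction.stabilizer (GL (Fin n) 𝕜) F₂ = MulAction.stabilizer (GL (Fin n) 𝕜) F₁ :=
      SetLike.coe_injective (hF₂.trans hF₁.symm)
    -- The representatives `F₁` and `F₂` have the same stabiliser, so conjugating from `g • F₁` back
    -- to `F₁` and on to `g' • F₂` suffices.
    refine ⟨g' * g⁻¹, ?_⟩
    have h1 : MulAction.stabilizer (GL (Fin n) 𝕜) (g' • F₁) =
        (MulAction.stabilizer (GL (Fin n) 𝕜) (g • F₁)).map
          (MulAut.conj (g' * g⁻¹)).toMonoidHom := by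
      rw [← MulAction.stabilizer_smul_eq_stabilizer_map_conj, smul_smul, inv_mul_cancel_right]
    change MulAction.stabilizer (GL (Fin n) 𝕜) (g' • F₂) = _
    rw [MulAction.stabilizer_smul_eq_stabilizer_map_conj, h12,
      ← MulAction.stabilizer_smul_eq_stabilizer_map_conj, h1]
  · have hA : A = p.I.card := by simpa using Fintype.card_congr I
    have hB : B = p.J.card := by simpa using Fintype.card_congr J
    have hC : C = p.K.card := by simpa using Fintype.card_congr K
    have hcard : Fintype.card (p.CoreIndex (A := A) J K) = p.rank := by
      have := blockIndex_card p I J K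
      have h1 : p.rank ≤ n := p.rank_le
      simp
      omega
    have hσ : Fintype.card p.Core = A + B + C := by simp [hA, hB, hC, add_assoc]
    -- This ensures that the subtraction in `ℕ` below is not truncated: every non-trivial summand
    -- has dimension at least `1`.
    have hle : A + B + C ≤ n * p.rank := by
      have hB' : B ≤ ∑ b ∈ p.J, (b.card - 1) := by
        rw [hB, Finset.card_eq_sum_ones]
        exact Finset.sum_le_sum fun b hb => by have := p.three_le_card b hb; omega
      have hC' : C ≤ ∑ c ∈ p.K, c.2 := by
        rw [hC, Finset.card_eq_sum_ones]
        exact Finset.sum_le_sum fun c hc => by have := p.four_le c hc; omega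
      have h1 : A + B + C ≤ p.rank := by
        rw [SplittingType.rank]
        omega
      exact h1.trans (Nat.le_mul_of_pos_left _ (by omega))
    refine ⟨n * p.rank - (A + B + C), ?_, fun O hO => ?_⟩
    · push_cast [Nat.cast_sub hle]
      ring
    · obtain ⟨F, hF, hFO⟩ := SplittingType.exists_mem_constructible_orbit hO
      obtain ⟨e, he⟩ := p.exists_isAdapted_coreBlock I J K hF
      rw [hFO]
      refine he.hasDimension_orbit ?_
      rw [hcard, hσ]
      omega
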